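/- For positive integers $s\le T$, call the following the $(s,T)$-patterns in a $2$-colouring of the edges of $K_{n,n}$ (colours red and blue): a copy of $K_{T,s+T}$ in which the edges of one colour form a graph isomorphic to $K_{T,T}$; or a copy of $K_{s,2T}$ in which the edges of one colour form a graph isomorphic to $K_{s,T}$. Let $z_2(n;s,T)$ be the least positive integer $z$ such that every $2$-colouring of $E(K_{n,n})$ with at least $z$ edges of each colour contains an $(s,T)$-pattern. Let $s\ge 1$ and $t$ be integers such that $1\le s\le 3\le t$ or $t\ge (s-1)!+1$. Then: (i) There are constants $c,C>0$ and $N$, depending only on $s$ and $t$, such that for every $n\ge N$ there is a $2$-colouring of $E(K_{n,n})$ whose number of blue edges is at least $c\,n^{2-1/s}$ and at most $C\,n^{2-1/s}$, whose number of red edges is at least $c\,n^{2-1/s}$, whose blue edges contain no copy of $K_{s,t}$, and which contains no $(s,T)$-pattern for any $T\ge t$. (ii) Consequently the order $n^{2-1/s}$ is tight: for every fixed $T\ge t$, $z_2(n;s,T)=\Theta(n^{2-1/s})$ as $n\to\infty$. -/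

import Mathlib

open Filter Asymptotics

/-- The complete bipartite graph `K_{a,b}`. -/
abbrev BipK (a b : ℕ) : SimpleGraph (Fin a ⊕ Fin b) :=
  completeBipartiteGraph (Fin a) (Fin b)

/-- The two colours. -/
inductive EdgeColor : Type
  | red
  | blue

/-- A (not necessarily proper) `2`-colouring of the edges of `K_{n,n}`. -/
abbrev BipColoring (n : ℕ) : Type :=
  (BipK n n).EdgeLabeling EdgeColor

/-- The number of edges of `K_{n,n}` that have colour `k`. -/
noncomputable def colorCount {n : ℕ} (χ : BipColoring n) (k : EdgeColor) : ℕ :=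
  (χ.labelGraph k).edgeSet.ncard

/-- The edges of the graph `L` form a graph isomorphic to `F`: once the isolated vertices
of `L` are discarded, what is left is isomorphic to `F`. -/
def EdgesForm {V W : Type} (L : SimpleGraph V) (F : SimpleGraph W) : Prop :=
  Nonempty (L.induce L.support ≃g F)

/-- The coloured `K_{n,n}` contains a copy of `H` in which the edges of one of the two colours
form a graph isomorphic to `F`. -/
def HasColoredCopy {n : ℕ} (χ : BipColoring n) {V W : Type}
    (H : SimpleGraph V) (F : SimpleGraph W) : Prop :=
  ∃ (φ : SimpleGraph.Copy H (BipK n n)) (k : EdgeColor),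
    EdgesForm ((χ.pullback φ.toHom).labelGraph k) F

/-- The unavoidable patterns with parameters `s ≤ T`: a copy of `K_{T,s+T}` in which one colour
forms a `K_{T,T}`, or a copy of `K_{s,2T}` in which one colour forms a `K_{s,T}`. -/
def HasPattern {n : ℕ} (χ : BipColoring n) (s T : ℕ) : Prop :=
  HasColoredCopy χ (BipK T (s + T)) (BipK T T) ∨
    HasColoredCopy χ (BipK s (2 * T)) (BipK s T)

/-- The positive integer `z` forces a pattern: every `2`-colouring of `K_{n,n}` with at least `z`
edges of each colour contains one. -/
def ForcesPattern (n s T z : ℕ) : Prop :=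
  0 < z ∧ ∀ χ : BipColoring n, (∀ k, z ≤ colorCount χ k) → HasPattern χ s T

/-- The threshold `z₂`: the least positive integer that forces a pattern. -/
noncomputable def zTwo (n s T : ℕ) : ℕ :=
  sInf {z | ForcesPattern n s T z}

/-- The minimum in the definition of `zTwo` is attained: it is never taken over the empty set. -/
theorem zTwo_isLeast (n s T : ℕ) : IsLeast {z | ForcesPattern n s T z} (zTwo n s T) := by
  have hne : {z | ForcesPattern n s T z}.Nonempty := by
    refine ⟨(BipK n n).edgeSet.ncard + 1, Nat.succ_pos _, fun χ h => ?_⟩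
    have h1 := h EdgeColor.red
    have h2 : colorCount χ EdgeColor.red ≤ (BipK n n).edgeSet.ncard :=
      Set.ncard_le_ncard (SimpleGraph.edgeSet_mono χ.labelGraph_le) (Set.toFinite _)
    omega
  exact ⟨Nat.sInf_mem hne, fun z hz => Nat.sInf_le hz⟩

/-!
# Unavoidable patterns in two-coloured complete bipartite graphs

Both alternatives of the hypothesis imply `t ≥ (s - 1)! + 1`, which is the range in which dense
`K_{s,t}`-free graphs are known explicitly.

*Construction.* Every pattern contains a `K_{s,T}`, a `K_{T,s}` or a `K_{T,T}` in blue
(`HasColoredCopy.exists_isContained`), so a colouring whose blue graph is `K_{s,t}`-free has no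
pattern with `T ≥ t`. For `s = 1` the blue graph is a perfect matching. For `s = m + 1 ≥ 2` it is
the bipartite double cover of a projective norm graph (Alon, Rónyai, Szabó) over a field with `p`
elements: vertices `(A, α) ∈ 𝔽_{p^m} × 𝔽_pˣ`, and `(A, α)` adjacent to `(B, β)` when
`N(A + B) = α β`. It has about `p^s` vertices and `p^{2s-1}` edges. Common neighbours of `s` given
vertices correspond to solutions of a system `∏ j, (x j - a i j) = c i` of `m` equations in `m`
unknowns, in which the entries of each column of `a` are distinct, and such a system has at most
`m!` solutions (`card_le_factorial_of_prod_sub_eq`).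

*Number of solutions.* Let `f i = ∏ j, (X j - a i j)`, let `B` be the polynomial ring and `A` its
subalgebra generated by the `f i`. The system has no solutions at infinity, which in terms of
valuation rings says that `B` is integral over `A` (`isIntegral_X_adjoin_linearProd`); hence the
`f i` are algebraically independent and `A` is integrally closed. Over the origin the fibre consists
of the `m!` points given by permutations, all simple, and Nakayama's lemma shows that `B` is
generated by `m!` elements over `A` up to a denominator (`exists_ne_zero_forall_smul_mem_span`).
So every `b ∈ B` has a minimal polynomial over `A` of degree at most `m!`. Specialised at any other
point `c`, it has the values of `b` at all solutions among its roots; choose `b` to separate them.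

*Upper bound on the threshold.* By double counting (`exists_biclique_of_le_ncard`), many edges of a
colour give a `K_{s,2T}` of that colour with the `s` vertices on the left. Let `Y` be its right
side. If many left vertices send `T` edges of the other colour to `Y`, there is a pattern of the
first kind; otherwise almost all left vertices send `T` edges of the given colour to `Y`. When this
happens for both colours, pigeonhole gives a pattern of the second kind
(`hasPattern_of_bicliques`).
-/

/-! ### Products of linear forms: finiteness of the fibres -/

/-- A system `∏ j, (x j - α i j) = c i` has no solution at infinity. If some `x j` had valuation
greater than `1`, each of the products would need a factor of valuation less than `1` to compensate.
Distinct rows need distinct columns for this, because the entries of a column are incongruent, and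
the column `j` itself is not available: there are too few columns left. -/
theorem ValuationSubring.mem_of_forall_prod_sub_mem {L ι : Type*} [Field L] [Fintype ι]
    (V : ValuationSubring L) {x : ι → L} {α : ι → ι → L} (hα : ∀ i j, α i j ∈ V)
    (hunit : ∀ i i' j, i ≠ i' → V.valuation (α i j - α i' j) = 1)
    (h : ∀ i, ∏ j, (x j - α i j) ∈ V) (j : ι) : x j ∈ V := by
  classical
  by_contra hj
  have hbig : ∀ i k, 1 < V.valuation (x k) → 1 < V.valuation (x k - α i k) := by
    intro i k hk
    have h1 : V.valuation (α i k) ≤ 1 := (V.valuation_le_one_iff _).2 (hα i k)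
    rw [Valuation.map_sub_eq_of_lt_left _ (h1.trans_lt hk)]
    exact hk
  have hj' : 1 < V.valuation (x j) := by
    rw [← not_le, V.valuation_le_one_iff]; exact hj
  have hex : ∀ i, ∃ k, V.valuation (x k - α i k) < 1 := by
    intro i
    by_contra! hcon
    have h1 : V.valuation (∏ k, (x k - α i k)) ≤ 1 := (V.valuation_le_one_iff _).2 (h i)
    rw [map_prod, ← Finset.mul_prod_erase _ _ (Finset.mem_univ j)] at h1
    have h2 : 1 ≤ ∏ k ∈ Finset.univ.erase j, V.valuation (x k - α i k) :=
      Finset.one_le_prod' fun k _ => hcon k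
    exact absurd h1 (not_le.2 ((hbig i j hj').trans_le (le_mul_of_one_le_right' h2)))
  choose κ hκ using hex
  have hinj : Function.Injective κ := by
    intro i i' hii
    by_contra hne
    have h1 := hunit i i' (κ i) hne
    have h2 : α i (κ i) - α i' (κ i) = (x (κ i) - α i' (κ i)) - (x (κ i) - α i (κ i)) := by ring
    have h3 := hκ i'
    rw [← hii] at h3
    have h4 := V.valuation.map_sub_lt h3 (hκ i)
    rw [← h2, h1] at h4
    exact lt_irrefl _ h4
  obtain ⟨i, hi⟩ := (Finite.injective_iff_surjective.1 hinj) j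
  have h5 := hκ i
  rw [hi] at h5
  exact lt_asymm h5 (hbig i j hj')

open MvPolynomial in
/-- The polynomial `∏ j, (X j - a i j)` attached to the row `i` of the square matrix `a`. -/
noncomputable def linearProd {K ι : Type*} [Field K] [Fintype ι] (a : ι → ι → K) (i : ι) :
    MvPolynomial ι K :=
  ∏ j, (X j - C (a i j))

section
variable {K ι : Type*} [Field K] [Fintype ι] {a : ι → ι → K}

open MvPolynomial

/-- The integral closure of a subring of a field is the intersection of the valuation rings that
contain it, so integrality of the coordinates is the absence of solutions at infinity. -/
theorem isIntegral_X_adjoin_linearProd (ha : ∀ j, Function.Injective fun i => a i j) (j : ι) :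
    IsIntegral (Algebra.adjoin K (Set.range (linearProd a))) (X j : MvPolynomial ι K) := by
  classical
  set A := Algebra.adjoin K (Set.range (linearProd a))
  let L := FractionRing (MvPolynomial ι K)
  let g := algebraMap (MvPolynomial ι K) L
  have hg : Function.Injective g := IsFractionRing.injective _ _
  let S : Set L := g '' (A : Set (MvPolynomial ι K))
  suffices hX : g (X j) ∈ (integralClosure (Subring.closure S) L).toSubring by
    have hX' : IsIntegral (Subring.closure S) (g (X j)) := hX
    have hcl : Subring.closure S = A.toSubring.map g := by
      refine le_antisymm (Subring.closure_le.2 fun y hy => hy) ?_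
      intro y hy
      exact Subring.subset_closure hy
    obtain ⟨P, hP, hP0⟩ := hX'
    have h1 : (algebraMap (Subring.closure S) L).range ≤ (g.comp (algebraMap A _)).range := by
      rintro _ ⟨⟨y, hy⟩, rfl⟩
      rw [hcl] at hy
      obtain ⟨z, hz, rfl⟩ := hy
      exact ⟨⟨z, hz⟩, rfl⟩
    have h2 : (g.comp (algebraMap A (MvPolynomial ι K))).IsIntegralElem (g (X j)) := by
      have h3 : P.map (algebraMap (Subring.closure S) L) ∈
          Polynomial.lifts (g.comp (algebraMap A (MvPolynomial ι K))) := by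
        rw [Polynomial.lifts_iff_coeff_lifts]
        intro n
        rw [Polynomial.coeff_map]
        exact h1 ⟨_, rfl⟩
      obtain ⟨Q, hQ, -, hQm⟩ := Polynomial.lifts_and_degree_eq_and_monic h3 (hP.map _)
      refine ⟨Q, hQm, ?_⟩
      rw [← Polynomial.eval_map, hQ, Polynomial.eval_map]
      exact hP0
    obtain ⟨Q, hQ, hQ0⟩ := h2
    refine ⟨Q, hQ, hg ?_⟩
    rw [map_zero, Polynomial.hom_eval₂]
    exact hQ0
  rw [← iInf_valuationSubring_superset, Subring.mem_iInf]
  rintro ⟨V, hV⟩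
  have hA : ∀ y ∈ A, g y ∈ V := fun y hy => hV ⟨y, hy, rfl⟩
  have hC : ∀ c : K, g (C c) ∈ V := fun c => hA _ (A.algebraMap_mem c)
  refine V.mem_of_forall_prod_sub_mem (x := fun j => g (X j)) (α := fun i j => g (C (a i j)))
    (fun i j => hC _) ?_ ?_ j
  · intro i i' j hii
    have hne : a i j - a i' j ≠ 0 := sub_ne_zero.2 fun h => hii (ha j h)
    have h1 : V.valuation (g (C (a i j - a i' j))) ≤ 1 := (V.valuation_le_one_iff _).2 (hC _)
    have h2 : V.valuation (g (C (a i j - a i' j)⁻¹)) ≤ 1 := (V.valuation_le_one_iff _).2 (hC _)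
    have h3 : V.valuation (g (C (a i j - a i' j))) *
        V.valuation (g (C (a i j - a i' j)⁻¹)) = 1 := by
      rw [← map_mul, ← map_mul, ← map_mul, mul_inv_cancel₀ hne, map_one, map_one, map_one]
    have h4 : V.valuation (g (C (a i j - a i' j))) = 1 :=
      le_antisymm h1 (by rw [← h3]; exact mul_le_of_le_one_right' h2)
    simpa using h4
  · intro i
    have := hA (linearProd a i) (Algebra.subset_adjoin ⟨i, rfl⟩)
    simpa [linearProd, map_prod] using this

theorem integral_adjoin_linearProd (ha : ∀ j, Function.Injective fun i => a i j) :
    Algebra.IsIntegral (Algebra.adjoin K (Set.range (linearProd a))) (MvPolynomial ι K) := by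
  set A := Algebra.adjoin K (Set.range (linearProd a))
  refine ⟨fun x => ?_⟩
  induction x using MvPolynomial.induction_on with
  | C c => exact isIntegral_algebraMap (x := (⟨C c, A.algebraMap_mem c⟩ : A))
  | add p q hp hq => exact hp.add hq
  | mul_X p j hp => exact hp.mul (isIntegral_X_adjoin_linearProd ha j)

/-- The `card ι` products generate a subalgebra over which a polynomial ring of transcendence degree
`card ι` is algebraic. -/
theorem algebraicIndependent_linearProd (ha : ∀ j, Function.Injective fun i => a i j) :
    AlgebraicIndependent K (linearProd a) := by
  have := integral_adjoin_linearProd ha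
  have : Algebra.IsAlgebraic (Algebra.adjoin K (Set.range (linearProd a))) (MvPolynomial ι K) :=
    inferInstance
  exact (Algebra.IsAlgebraic.isTranscendenceBasis_of_lift_le_trdeg_of_finite K (linearProd a)
    (by simp)).1

theorem isIntegrallyClosed_adjoin_linearProd (ha : ∀ j, Function.Injective fun i => a i j) :
    IsIntegrallyClosed (Algebra.adjoin K (Set.range (linearProd a))) :=
  IsIntegrallyClosed.of_equiv
    (algebraicIndependent_linearProd ha).aevalEquiv.toRingEquiv

theorem finite_adjoin_linearProd (ha : ∀ j, Function.Injective fun i => a i j) :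
    Module.Finite (Algebra.adjoin K (Set.range (linearProd a))) (MvPolynomial ι K) := by
  have := integral_adjoin_linearProd ha
  have : Algebra.FiniteType (Algebra.adjoin K (Set.range (linearProd a))) (MvPolynomial ι K) :=
    Algebra.FiniteType.of_restrictScalars_finiteType K _ _
  exact Algebra.IsIntegral.finite
end

/-! ### Products of linear forms: the number of solutions -/

/-- If a nonzero multiple of `B` lies in the span of the family `u`, then any `card κ + 1`
powers of `b` are linearly dependent, and since `A` is integrally closed the minimal polynomial of
`b` divides the relation. -/
theorem minpoly.natDegree_le_card_of_smul_mem_span {A B κ : Type*} [CommRing A] [IsDomain A]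
    [IsIntegrallyClosed A] [CommRing B] [IsDomain B] [Algebra A B] [Module.IsTorsionFree A B]
    [Fintype κ] {u : κ → B} {r : A} (hr0 : r ≠ 0)
    (hr : ∀ g : B, r • g ∈ Submodule.span A (Set.range u)) {b : B} (hb : IsIntegral A b) :
    (minpoly A b).natDegree ≤ Fintype.card κ := by
  classical
  set N := Fintype.card κ with hN
  have hrel : ∀ k : Fin (N + 1), ∃ v : κ → A,
      ∑ σ, v σ • u σ = r • b ^ (k : ℕ) := fun k =>
    (Submodule.mem_span_range_iff_exists_fun A).1 (hr _)
  choose v hv using hrel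
  have hdep : ¬ LinearIndependent A v := by
    intro hli
    have := hli.fintype_card_le_finrank
    rw [Module.finrank_fintype_fun_eq_card, Fintype.card_fin] at this
    omega
  obtain ⟨g, hg, k, hk⟩ := Fintype.not_linearIndependent_iff.1 hdep
  let P : Polynomial A := ∑ k : Fin (N + 1), Polynomial.monomial (k : ℕ) (g k)
  have hcoeff : P.coeff k = g k := by
    simp [P, Polynomial.coeff_monomial, Fin.val_inj]
  have hP0 : P ≠ 0 := fun h => hk (by rw [← hcoeff, h, Polynomial.coeff_zero])
  have hPdeg : P.natDegree ≤ N := Polynomial.natDegree_sum_le_of_forall_le _ _ fun k _ =>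
    (Polynomial.natDegree_monomial_le _).trans (Nat.lt_succ_iff.1 k.2)
  have hroot : Polynomial.aeval b P = 0 := by
    have h1 : r • Polynomial.aeval b P = 0 := by
      have h2 : Polynomial.aeval b P = ∑ k, g k • b ^ (k : ℕ) := by
        simp [P, Polynomial.aeval_monomial, Algebra.smul_def]
      rw [h2, Finset.smul_sum]
      simp_rw [smul_comm r, ← hv, Finset.smul_sum, smul_smul]
      rw [Finset.sum_comm]
      simp_rw [← Finset.sum_smul]
      refine Finset.sum_eq_zero fun σ _ => ?_
      have := congrFun hg σ
      simp only [Finset.sum_apply, Pi.smul_apply, smul_eq_mul, Pi.zero_apply] at this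
      rw [this, zero_smul]
    exact (smul_eq_zero.1 h1).resolve_left hr0
  exact (Polynomial.natDegree_le_of_dvd
    (minpoly.isIntegrallyClosed_dvd hb hroot) hP0).trans hPdeg


section
variable {K ι : Type*} [Field K] [Fintype ι] [DecidableEq ι] {a : ι → ι → K}

open MvPolynomial

/-- For a permutation `σ`, the product of all linear forms `X j - a i j` other than those that vanish
at the zero `j ↦ a (σ⁻¹ j) j` of the polynomials `linearProd a`. -/
noncomputable def cofactorProd (a : ι → ι → K) (σ : Equiv.Perm ι) : MvPolynomial ι K :=
  ∏ i, ∏ j ∈ Finset.univ.erase (σ i), (X j - C (a i j))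

theorem cofactorProd_mul_X_sub_C_mem (σ : Equiv.Perm ι) (i : ι) :
    cofactorProd a σ * (X (σ i) - C (a i (σ i))) ∈ Ideal.span (Set.range (linearProd a)) := by
  rw [cofactorProd, ← Finset.mul_prod_erase _ _ (Finset.mem_univ i), mul_right_comm,
    Finset.prod_erase_mul _ _ (Finset.mem_univ (σ i))]
  exact Ideal.mul_mem_right _ _ (Ideal.subset_span ⟨i, rfl⟩)

/-- A maximal ideal containing all the products contains some `X (κ i) - a i (κ i)` for every row
`i`. As the entries of each column are distinct, `κ` is a permutation, and the ideal contains no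
other linear form, hence does not contain `cofactorProd a κ`. -/
theorem span_linearProd_sup_span_cofactorProd (ha : ∀ j, Function.Injective fun i => a i j) :
    Ideal.span (Set.range (linearProd a)) ⊔ Ideal.span (Set.range (cofactorProd a)) = ⊤ := by
  by_contra hne
  obtain ⟨M, hM, hle⟩ := Ideal.exists_le_maximal _ hne
  have hprime := hM.isPrime
  have hex : ∀ i, ∃ j, (X j - C (a i j) : MvPolynomial ι K) ∈ M := by
    intro i
    have h1 : linearProd a i ∈ M := hle (Ideal.mem_sup_left (Ideal.subset_span ⟨i, rfl⟩))
    obtain ⟨j, -, hj⟩ := (Ideal.IsPrime.prod_mem_iff (hp := hprime)).1 h1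
    exact ⟨j, hj⟩
  have hno : ∀ i i' j, i ≠ i' → (X j - C (a i j) : MvPolynomial ι K) ∈ M →
      (X j - C (a i' j) : MvPolynomial ι K) ∉ M := by
    intro i i' j hii h1 h2
    have hz : a i j - a i' j ≠ 0 := sub_ne_zero.2 fun h => hii (ha j h)
    have h3 : (C (a i j - a i' j) : MvPolynomial ι K) ∈ M := by
      have := M.sub_mem h2 h1
      rw [map_sub]
      convert this using 1
      ring
    exact hM.ne_top (Ideal.eq_top_of_isUnit_mem _ h3 ((isUnit_iff_ne_zero.2 hz).map C))
  choose κ hκ using hex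
  have hinj : Function.Injective κ := by
    intro i i' hii
    by_contra hne'
    exact hno i i' (κ i) hne' (hκ i) (hii ▸ hκ i')
  let σ := Equiv.ofBijective κ (Finite.injective_iff_bijective.1 hinj)
  have h1 : cofactorProd a σ ∈ M := hle (Ideal.mem_sup_right (Ideal.subset_span ⟨σ, rfl⟩))
  obtain ⟨i, -, hi⟩ := (Ideal.IsPrime.prod_mem_iff (hp := hprime)).1 h1
  obtain ⟨j, hj, hij⟩ := (Ideal.IsPrime.prod_mem_iff (hp := hprime)).1 hi
  obtain ⟨i', rfl⟩ := σ.surjective j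
  refine hno i' i (σ i') ?_ (hκ i') hij
  rintro rfl
  exact (Finset.mem_erase.1 hj).1 rfl

/-- Modulo the ideal of the products, multiplication by `cofactorProd a σ` is evaluation at the zero
that belongs to `σ`. -/
theorem mul_cofactorProd_sub_mem (σ : Equiv.Perm ι) (g : MvPolynomial ι K) :
    g * cofactorProd a σ - C (eval (fun j => a (σ.symm j) j) g) * cofactorProd a σ ∈
      Ideal.span (Set.range (linearProd a)) := by
  induction g using MvPolynomial.induction_on with
  | C c => simp
  | add p q hp hq =>
    rw [map_add, map_add]
    convert Ideal.add_mem _ hp hq using 1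
    ring
  | mul_X p j hp =>
    have h1 := cofactorProd_mul_X_sub_C_mem (a := a) σ (σ.symm j)
    rw [Equiv.apply_symm_apply] at h1
    rw [map_mul, eval_X, map_mul]
    convert Ideal.add_mem _ (Ideal.mul_mem_right (C (a (σ.symm j) j)) _ hp)
      (Ideal.mul_mem_left _ p h1) using 1
    ring

/-- Over the subalgebra `A` generated by the products, the polynomial ring is generated by the
`(card ι)!` elements `cofactorProd a σ`, up to a common denominator `r`. This holds modulo the ideal
of the origin by `span_linearProd_sup_span_cofactorProd` and lifts by Nakayama's lemma. -/
theorem exists_ne_zero_forall_smul_mem_span (ha : ∀ j, Function.Injective fun i => a i j) :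
    ∃ r : Algebra.adjoin K (Set.range (linearProd a)), r ≠ 0 ∧
      ∀ g : MvPolynomial ι K,
        r • g ∈ Submodule.span (Algebra.adjoin K (Set.range (linearProd a)))
          (Set.range (cofactorProd a)) := by
  set A := Algebra.adjoin K (Set.range (linearProd a)) with hA
  have hmem : ∀ i, linearProd a i ∈ A := fun i => Algebra.subset_adjoin ⟨i, rfl⟩
  let m : Ideal A := Ideal.span (Set.range fun i => ⟨linearProd a i, hmem i⟩)
  have hm : ∀ w ∈ Ideal.span (Set.range (linearProd a)), w ∈ m • (⊤ : Submodule A _) := by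
    intro w hw
    induction hw using Submodule.span_induction with
    | zero => exact Submodule.zero_mem _
    | add x y _ _ hx hy => exact Submodule.add_mem _ hx hy
    | smul b x hx' hx =>
      refine Submodule.smul_induction_on (p := fun x => b • x ∈ m • (⊤ : Submodule A _)) hx ?_ ?_
      · intro r hr n _
        rw [smul_comm]
        exact Submodule.smul_mem_smul hr trivial
      · intro x y h1 h2
        rw [smul_add]
        exact Submodule.add_mem _ h1 h2
    | mem x hx =>
      obtain ⟨i, rfl⟩ := hx
      have : linearProd a i = (⟨linearProd a i, hmem i⟩ : A) • (1 : MvPolynomial ι K) := by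
        rw [Algebra.smul_def, mul_one]; rfl
      rw [this]
      exact Submodule.smul_mem_smul (Ideal.subset_span ⟨i, rfl⟩) trivial
  have hsup : (⊤ : Submodule A (MvPolynomial ι K)) ≤
      Submodule.span A (Set.range (cofactorProd a)) ⊔ m • ⊤ := by
    intro g _
    have h1 : (1 : MvPolynomial ι K) ∈
        Ideal.span (Set.range (linearProd a)) ⊔ Ideal.span (Set.range (cofactorProd a)) := by
      rw [span_linearProd_sup_span_cofactorProd ha]; trivial
    obtain ⟨w, hw, z, hz, hwz⟩ := Submodule.mem_sup.1 h1
    obtain ⟨h, rfl⟩ := (Ideal.mem_span_range_iff_exists_fun).1 hz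
    have h2 : g = ∑ σ, C (eval (fun j => a (σ.symm j) j) (g * h σ)) * cofactorProd a σ +
        (g * w + ∑ σ, (g * h σ * cofactorProd a σ -
          C (eval (fun j => a (σ.symm j) j) (g * h σ)) * cofactorProd a σ)) := by
      rw [Finset.sum_sub_distrib]
      calc g = g * 1 := (mul_one g).symm
        _ = _ := by
          rw [← hwz, mul_add, Finset.mul_sum]
          simp only [mul_assoc]
          ring
    rw [h2]
    refine Submodule.add_mem_sup (Submodule.sum_mem _ fun σ _ => ?_) (hm _ ?_)
    -- The coefficients are constants, hence lie in `A`.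
    · exact Submodule.smul_mem _ (⟨C _, A.algebraMap_mem _⟩ : A) (Submodule.subset_span ⟨σ, rfl⟩)
    · exact Ideal.add_mem _ (Ideal.mul_mem_left _ _ hw)
        (Ideal.sum_mem _ fun σ _ => mul_cofactorProd_sub_mem σ _)
  have hfin := finite_adjoin_linearProd ha
  obtain ⟨r, hr, hle⟩ := Submodule.exists_sub_one_mem_and_smul_le_of_fg_of_le_sup
    hfin.fg_top le_top hsup
  refine ⟨r, ?_, fun g => hle (Submodule.smul_mem_pointwise_smul g r ⊤ trivial)⟩
  rintro rfl
  -- All products vanish at the point `j ↦ a j j`, so `m` is a proper ideal and `0 - 1 ∉ m`.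
  let ε : A →ₐ[K] K := (aeval fun j => a j j).comp A.val
  have hker : m ≤ RingHom.ker ε := by
    rw [Ideal.span_le]
    rintro _ ⟨i, rfl⟩
    change aeval (fun j => a j j) (linearProd a i) = 0
    rw [linearProd, map_prod]
    exact Finset.prod_eq_zero (Finset.mem_univ i) (by simp)
  have h3 := hker hr
  simp [RingHom.mem_ker] at h3

theorem natDegree_minpoly_le_factorial (ha : ∀ j, Function.Injective fun i => a i j)
    (b : MvPolynomial ι K) :
    (minpoly (Algebra.adjoin K (Set.range (linearProd a))) b).natDegree ≤
      (Fintype.card ι).factorial := by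
  have := isIntegrallyClosed_adjoin_linearProd ha
  obtain ⟨r, hr0, hr⟩ := exists_ne_zero_forall_smul_mem_span ha
  rw [← Fintype.card_perm]
  exact minpoly.natDegree_le_card_of_smul_mem_span hr0 hr
    ((integral_adjoin_linearProd ha).isIntegral b)

end

section
variable {K ι : Type*} [Field K] [Fintype ι] {a : ι → ι → K}

open MvPolynomial

/-- A linear form that is injective on a given finite set of points. -/
theorem exists_eval_injOn [Infinite K] (S : Finset (ι → K)) :
    ∃ b : MvPolynomial ι K, Set.InjOn (fun x => eval x b) (S : Set (ι → K)) := by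
  classical
  obtain ⟨φ, hφ⟩ := Module.exists_dual_forall_apply_ne_zero (K := K)
    (fun p : {p : (ι → K) × (ι → K) // p ∈ S.offDiag} => p.1.1 - p.1.2)
    (fun p => sub_ne_zero.2 (Finset.mem_offDiag.1 p.2).2.2)
  refine ⟨∑ j, C (φ (Pi.single j 1)) * X j, fun x hx y hy hxy => ?_⟩
  have key : ∀ z, eval z (∑ j, C (φ (Pi.single j 1)) * X j) = φ z := by
    intro z
    conv_rhs => rw [pi_eq_sum_univ' z]
    simp [map_sum, mul_comm]
  by_contra hne
  refine hφ ⟨(x, y), Finset.mem_offDiag.2 ⟨hx, hy, hne⟩⟩ ?_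
  rw [map_sub, ← key, ← key]
  exact sub_eq_zero.2 hxy

/-- The case of an infinite field. Specialising the minimal polynomial of a polynomial `b` at the
common value `c` of the products gives a monic polynomial of degree at most `(card ι)!` whose roots
include the values of `b` at all solutions. -/
theorem card_le_factorial_of_infinite [Infinite K] (ha : ∀ j, Function.Injective fun i => a i j)
    (c : ι → K) (S : Finset (ι → K)) (hS : ∀ x ∈ S, ∀ i, ∏ j, (x j - a i j) = c i) :
    S.card ≤ (Fintype.card ι).factorial := by
  classical
  obtain ⟨b, hb⟩ := exists_eval_injOn S
  rcases S.eq_empty_or_nonempty with rfl | ⟨x₀, hx₀⟩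
  · simp
  have hint := (integral_adjoin_linearProd ha).isIntegral b
  have hdeg := natDegree_minpoly_le_factorial ha b
  set A := Algebra.adjoin K (Set.range (linearProd a)) with hA
  let ε : (ι → K) → A →ₐ[K] K := fun x => (aeval x).comp A.val
  have hε : ∀ x ∈ S, ε x = ε x₀ := by
    intro x hx
    refine AlgHom.adjoin_ext ?_
    rintro _ ⟨i, rfl⟩
    simp [ε, linearProd, hS x hx i, hS x₀ hx₀ i]
  let Q := (minpoly A b).map (ε x₀ : A →+* K)
  have hQ : Q.Monic := (minpoly.monic hint).map _
  have hroots : S.image (fun x => eval x b) ⊆ Q.roots.toFinset := by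
    intro y hy
    obtain ⟨x, hx, rfl⟩ := Finset.mem_image.1 hy
    rw [Multiset.mem_toFinset, Polynomial.mem_roots hQ.ne_zero, Polynomial.IsRoot,
      Polynomial.eval_map, ← hε x hx]
    have h1 := congrArg (aeval x : MvPolynomial ι K →ₐ[K] K) (minpoly.aeval A b)
    rw [map_zero, Polynomial.aeval_def, ← AlgHom.coe_toRingHom, Polynomial.hom_eval₂] at h1
    exact h1
  calc S.card = (S.image fun x => eval x b).card := (Finset.card_image_of_injOn hb).symm
    _ ≤ Q.roots.toFinset.card := Finset.card_le_card hroots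
    _ ≤ Q.natDegree := (Multiset.toFinset_card_le _).trans (Polynomial.card_roots' _)
    _ ≤ _ := (Polynomial.natDegree_map_le).trans hdeg

/-- Kollár–Rónyai–Szabó: if the entries of each column of `a` are distinct, the system
`∏ j, (x j - a i j) = c i` has at most `(card ι)!` solutions. -/
theorem card_le_factorial_of_prod_sub_eq (ha : ∀ j, Function.Injective fun i => a i j)
    (c : ι → K) (S : Finset (ι → K)) (hS : ∀ x ∈ S, ∀ i, ∏ j, (x j - a i j) = c i) :
    S.card ≤ (Fintype.card ι).factorial := by
  classical
  let g := algebraMap K (AlgebraicClosure K)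
  have hg : Function.Injective g := g.injective
  have hinj : Function.Injective fun x : ι → K => fun j => g (x j) := fun x y h =>
    funext fun j => hg (congrFun h j)
  rw [← Finset.card_image_of_injective S hinj]
  refine card_le_factorial_of_infinite (a := fun i j => g (a i j))
    (fun j i i' h => ha j (hg h)) (fun i => g (c i)) _ ?_
  intro y hy i
  obtain ⟨x, hx, rfl⟩ := Finset.mem_image.1 hy
  simp [← hS x hx i]
end

/-! ### The projective norm graph -/

/-- Adjacency in the projective norm graph of a finite extension `K / F`: the vertices are the pairs
`(A, α)` with `A ∈ K` and `α ∈ Fˣ`, and `(A, α)`, `(B, β)` are adjacent when `N(A + B) = α β`.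
Loops are allowed, since only its bipartite double cover is used. -/
def NormAdj (F K : Type*) [Field F] [Field K] [Algebra F K] (v w : K × Fˣ) : Prop :=
  Algebra.norm F (v.1 + w.1) = v.2 * w.2

section
variable {F K : Type*} [Field F] [Field K] [Algebra F K]

theorem NormAdj.symm {v w : K × Fˣ} (h : NormAdj F K v w) : NormAdj F K w v := by
  unfold NormAdj at *
  rw [add_comm, h, mul_comm]

theorem NormAdj.snd_eq {v w w' : K × Fˣ} (h : NormAdj F K v w) (h' : NormAdj F K v w')
    (he : w.1 = w'.1) : w = w' := by
  unfold NormAdj at *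
  rw [he, h'] at h
  exact Prod.ext he (Units.ext (mul_left_cancel₀ v.2.ne_zero h.symm))

theorem NormAdj.add_ne_zero [FiniteDimensional F K] {v w : K × Fˣ} (h : NormAdj F K v w) :
    v.1 + w.1 ≠ 0 := by
  intro h0
  unfold NormAdj at h
  rw [h0, Algebra.norm_zero] at h
  exact mul_ne_zero v.2.ne_zero w.2.ne_zero h.symm

/-- Any `m + 1` distinct vertices of the projective norm graph of an extension of degree `m` have at
most `m!` common neighbours: dividing the equation of each vertex by that of the vertex `0` leaves
`m` equations for `1 / (A₀ + B)`, which turn into a system of products of linear forms in its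
conjugates. -/
theorem card_common_normAdj_le [Finite K] {m : ℕ} (hm : Module.finrank F K = m)
    (v : Fin (m + 1) → K × Fˣ) (hv : Function.Injective v) (S : Finset (K × Fˣ))
    (hS : ∀ w ∈ S, ∀ i, NormAdj F K (v i) w) :
    S.card ≤ m.factorial := by
  classical
  rcases S.eq_empty_or_nonempty with rfl | ⟨w₀, hw₀⟩
  · simp
  have hF : Finite F := Finite.of_injective _ (algebraMap F K).injective
  have := Fintype.ofFinite F
  have hfd : FiniteDimensional F K := Module.Finite.of_finite
  have hpos : 0 < m := hm ▸ Module.finrank_pos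
  have hA : ∀ i j, (v i).1 = (v j).1 → i = j := fun i j hij =>
    hv ((hS w₀ hw₀ i).symm.snd_eq (hS w₀ hw₀ j).symm hij)
  let D : Fin m → K := fun i => (v i.succ).1 - (v 0).1
  have hD : ∀ i, D i ≠ 0 := fun i h => Fin.succ_ne_zero i (hA _ _ (sub_eq_zero.1 h))
  let φ : ℕ → K →ₐ[F] K := fun k => FiniteField.frobeniusAlgHom F K ^ k
  have hφ : ∀ k x, φ k x = x ^ Nat.card F ^ k := by
    intro k x
    simp only [φ, AlgHom.coe_pow, FiniteField.coe_frobeniusAlgHom, pow_iterate,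
      Nat.card_eq_fintype_card]
  have hnorm : ∀ x : K, algebraMap F K (Algebra.norm F x) = ∏ k : Fin m, φ k x := by
    intro x
    rw [FiniteField.algebraMap_norm_eq_prod_pow, hm, Finset.prod_range]
    exact Finset.prod_congr rfl fun k _ => (hφ k x).symm
  -- The unknowns are the conjugates of `1 / (A₀ + B)`.
  let T : K × Fˣ → Fin m → K := fun w k => φ k ((v 0).1 + w.1)⁻¹
  have hT : Set.InjOn T S := by
    intro w hw w' hw' h
    have h0 := congrFun h ⟨0, hpos⟩
    have h1 : ((v 0).1 + w.1)⁻¹ = ((v 0).1 + w'.1)⁻¹ := (φ 0).injective h0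
    exact (hS w hw 0).snd_eq (hS w' hw' 0) (add_left_cancel (inv_injective h1))
  rw [← Finset.card_image_of_injOn hT]
  have key := card_le_factorial_of_prod_sub_eq (K := K) (ι := Fin m)
    (a := fun i k => φ k (-(D i)⁻¹))
    (fun k i j hij => by
      have h1 : -(D i)⁻¹ = -(D j)⁻¹ := (φ k).injective hij
      have h2 : D i = D j := inv_injective (neg_injective h1)
      exact Fin.succ_injective _ (hA _ _ (sub_left_injective h2)))
    (fun i => algebraMap F K
      ((v i.succ).2 / (v 0).2 * (Algebra.norm F (D i))⁻¹)) (S.image T) ?_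
  · simpa using key
  intro x hx i
  obtain ⟨w, hw, rfl⟩ := Finset.mem_image.1 hx
  have hz := (hS w hw 0).add_ne_zero
  simp only [T, ← map_sub]
  rw [← hnorm]
  congr 1
  have h1 := hS w hw i.succ
  have h2 := hS w hw 0
  unfold NormAdj at h1 h2
  have h3 : ((v 0).1 + w.1)⁻¹ - -(D i)⁻¹ =
      ((v i.succ).1 + w.1) * ((v 0).1 + w.1)⁻¹ * (D i)⁻¹ := by
    have := hD i
    field_simp
    simp only [D]
    ring
  rw [h3, map_mul, map_mul, h1, Algebra.norm_inv, Algebra.norm_inv, h2]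
  have := w.2.ne_zero
  have := (v 0).2.ne_zero
  field_simp

variable (F K)

/-- A neighbour of a given vertex is determined by its first coordinate. -/
theorem ncard_normAdj_le [Finite K] :
    {e : (K × Fˣ) × (K × Fˣ) | NormAdj F K e.1 e.2}.ncard ≤
      Nat.card K * Nat.card Fˣ * Nat.card K := by
  have hF : Finite F := Finite.of_injective _ (algebraMap F K).injective
  rw [← Nat.card_prod, ← Nat.card_prod, ← Set.ncard_univ]
  refine Set.ncard_le_ncard_of_injOn (fun e => (e.1, e.2.1)) (fun _ _ => trivial) ?_
  rintro ⟨v, w⟩ h ⟨v', w'⟩ h' he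
  simp only [Prod.mk.injEq] at he
  obtain ⟨rfl, he⟩ := he
  exact Prod.ext rfl (NormAdj.snd_eq h h' he)

/-- A vertex `(A, α)` has a neighbour with first coordinate `z - A` for every `z ≠ 0`. -/
theorem le_ncard_normAdj [Finite K] :
    Nat.card K * Nat.card Fˣ * Nat.card Kˣ ≤
      {e : (K × Fˣ) × (K × Fˣ) | NormAdj F K e.1 e.2}.ncard := by
  have hF : Finite F := Finite.of_injective _ (algebraMap F K).injective
  have hfd : FiniteDimensional F K := Module.Finite.of_finite
  rw [← Nat.card_prod, ← Nat.card_prod, ← Set.ncard_univ]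
  refine Set.ncard_le_ncard_of_injOn
    (fun y : (K × Fˣ) × Kˣ => (y.1, ((y.2 : K) - y.1.1, Units.map (Algebra.norm F) y.2 / y.1.2)))
    ?_ ?_
  · rintro ⟨⟨A, a⟩, z⟩ -
    simp [NormAdj, mul_div_cancel₀]
  · rintro ⟨⟨A, a⟩, z⟩ - ⟨⟨A', a'⟩, z'⟩ - h
    simp only [Prod.mk.injEq] at h
    obtain ⟨⟨rfl, rfl⟩, h, -⟩ := h
    simp [Units.ext (sub_left_injective h)]
end

/-! ### Complete bipartite graphs inside coloured complete bipartite graphs -/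

theorem EdgeColor.eq_or_eq_of_ne {k k' : EdgeColor} (h : k ≠ k') (l : EdgeColor) :
    l = k ∨ l = k' := by
  cases k <;> cases k' <;> cases l <;> simp_all

theorem labelGraph_adj_of_not_adj {V : Type} {G : SimpleGraph V} (χ : G.EdgeLabeling EdgeColor)
    {k k' : EdgeColor} (hk : k ≠ k') {x y : V} (hxy : G.Adj x y)
    (h : ¬ (χ.labelGraph k).Adj x y) : (χ.labelGraph k').Adj x y := by
  rw [SimpleGraph.EdgeLabeling.labelGraph_adj] at h ⊢
  refine ⟨hxy, ?_⟩
  exact (EdgeColor.eq_or_eq_of_ne hk _).resolve_left fun h' => h ⟨hxy, h'⟩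

theorem not_labelGraph_adj_of_adj {V : Type} {G : SimpleGraph V} (χ : G.EdgeLabeling EdgeColor)
    {k k' : EdgeColor} (hk : k ≠ k') {x y : V} (h : (χ.labelGraph k).Adj x y) :
    ¬ (χ.labelGraph k').Adj x y := by
  rw [SimpleGraph.EdgeLabeling.labelGraph_adj] at h ⊢
  rintro ⟨_, h'⟩
  obtain ⟨_, h⟩ := h
  exact hk (h.symm.trans h')

theorem exists_coloring_blue_iff {n : ℕ} (R : Fin n → Fin n → Prop) :
    ∃ χ : BipColoring n, ∀ x y,
      (χ.labelGraph EdgeColor.blue).Adj (Sum.inl x) (Sum.inr y) ↔ R x y := by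
  classical
  let χ : BipColoring n := fun e =>
    if ∃ x y, R x y ∧ e.1 = s(Sum.inl x, Sum.inr y) then .blue else .red
  refine ⟨χ, fun x y => ?_⟩
  rw [SimpleGraph.EdgeLabeling.labelGraph_adj]
  simp [χ]

theorem colorCount_eq_ncard {n : ℕ} (χ : BipColoring n) (k : EdgeColor) :
    colorCount χ k =
      {e : Fin n × Fin n | (χ.labelGraph k).Adj (Sum.inl e.1) (Sum.inr e.2)}.ncard := by
  have hinj : Function.Injective
      fun e : Fin n × Fin n => s((Sum.inl e.1 : Fin n ⊕ Fin n), Sum.inr e.2) := by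
    rintro ⟨x, y⟩ ⟨x', y'⟩ h
    simpa using h
  rw [colorCount, ← Set.ncard_image_of_injective _ hinj]
  congr 1
  ext e
  induction e using Sym2.ind with
  | _ u v =>
    simp only [SimpleGraph.mem_edgeSet, Set.mem_image, Prod.exists]
    constructor
    · intro h
      have hle := χ.labelGraph_le h
      rcases u with u | u <;> rcases v with v | v
      · simp at hle
      · exact ⟨u, v, h, rfl⟩
      · exact ⟨v, u, h.symm, Sym2.eq_swap⟩
      · simp at hle
    · rintro ⟨x, y, h, he⟩
      rw [← SimpleGraph.mem_edgeSet, ← he]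
      exact h

theorem colorCount_red_add_blue {n : ℕ} (χ : BipColoring n) :
    colorCount χ .red + colorCount χ .blue = n ^ 2 := by
  rw [colorCount_eq_ncard, colorCount_eq_ncard]
  have hc : {e : Fin n × Fin n | (χ.labelGraph .red).Adj (Sum.inl e.1) (Sum.inr e.2)} =
      {e : Fin n × Fin n | (χ.labelGraph .blue).Adj (Sum.inl e.1) (Sum.inr e.2)}ᶜ := by
    ext e
    exact ⟨fun h => not_labelGraph_adj_of_adj χ (by simp) h,
      fun h => labelGraph_adj_of_not_adj χ (by simp) (by simp) h⟩
  rw [hc, add_comm, Set.ncard_add_ncard_compl]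
  simp [sq]

/-- A homomorphism between complete bipartite graphs, the source with nonempty parts, either
preserves or exchanges the two sides. -/
theorem BipK.hom_aligned {a b c d : ℕ} (ha : 0 < a) (hb : 0 < b) (φ : BipK a b →g BipK c d) :
    (∃ (f : Fin a → Fin c) (g : Fin b → Fin d),
      (∀ i, φ (.inl i) = .inl (f i)) ∧ ∀ j, φ (.inr j) = .inr (g j)) ∨
    ∃ (f : Fin a → Fin d) (g : Fin b → Fin c),
      (∀ i, φ (.inl i) = .inr (f i)) ∧ ∀ j, φ (.inr j) = .inl (g j) := by
  have hadj : ∀ i j, (BipK c d).Adj (φ (.inl i)) (φ (.inr j)) := fun i j =>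
    φ.map_rel (by simp)
  rcases h0 : φ (.inl ⟨0, ha⟩) with x | x
  · left
    have hg : ∀ j, ∃ y, φ (.inr j) = .inr y := by
      intro j
      have := hadj ⟨0, ha⟩ j
      rw [h0] at this
      rcases h1 : φ (.inr j) with y | y
      · simp [h1] at this
      · exact ⟨y, rfl⟩
    have hf : ∀ i, ∃ y, φ (.inl i) = .inl y := by
      intro i
      obtain ⟨z, hz⟩ := hg ⟨0, hb⟩
      have := hadj i ⟨0, hb⟩
      rw [hz] at this
      rcases h1 : φ (.inl i) with y | y
      · exact ⟨y, rfl⟩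
      · simp [h1] at this
    choose f hf using hf
    choose g hg using hg
    exact ⟨f, g, hf, hg⟩
  · right
    have hg : ∀ j, ∃ y, φ (.inr j) = .inl y := by
      intro j
      have := hadj ⟨0, ha⟩ j
      rw [h0] at this
      rcases h1 : φ (.inr j) with y | y
      · exact ⟨y, rfl⟩
      · simp [h1] at this
    have hf : ∀ i, ∃ y, φ (.inl i) = .inr y := by
      intro i
      obtain ⟨z, hz⟩ := hg ⟨0, hb⟩
      have := hadj i ⟨0, hb⟩
      rw [hz] at this
      rcases h1 : φ (.inl i) with y | y
      · simp [h1] at this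
      · exact ⟨y, rfl⟩
    choose f hf using hf
    choose g hg using hg
    exact ⟨f, g, hf, hg⟩

theorem BipK.isContained_of_forall_adj {V : Type} {G : SimpleGraph V} {a b : ℕ}
    (f : Fin a → V) (g : Fin b → V) (hf : Function.Injective f) (hg : Function.Injective g)
    (h : ∀ i j, G.Adj (f i) (g j)) : (BipK a b).IsContained G := by
  refine ⟨⟨⟨Sum.elim f g, ?_⟩, ?_⟩⟩
  · rintro (i | i) (j | j) hij
    · simp at hij
    · exact h i j
    · exact (h j i).symm
    · simp at hij
  · exact hf.sumElim hg fun i j => (h i j).ne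

theorem BipK.isContained_of_le {a b a' b' : ℕ} (ha : a ≤ a') (hb : b ≤ b') :
    (BipK a b).IsContained (BipK a' b') :=
  BipK.isContained_of_forall_adj (fun i => .inl (Fin.castLE ha i)) (fun j => .inr (Fin.castLE hb j))
    (Sum.inl_injective.comp (Fin.castLE_injective ha))
    (Sum.inr_injective.comp (Fin.castLE_injective hb)) (by simp)

theorem BipK.isContained_swap (a b : ℕ) : (BipK a b).IsContained (BipK b a) :=
  BipK.isContained_of_forall_adj .inr .inl Sum.inr_injective Sum.inl_injective (by simp)

theorem BipK.free_labelGraph {n s t : ℕ} (hs : 0 < s) (ht : 0 < t) {χ : BipColoring n}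
    {k : EdgeColor} {R : Fin n → Fin n → Prop}
    (hR : ∀ x y, (χ.labelGraph k).Adj (.inl x) (.inr y) ↔ R x y) (hsymm : ∀ x y, R x y → R y x)
    (hfree : ∀ (f : Fin s → Fin n) (g : Fin t → Fin n), Function.Injective f →
      Function.Injective g → ¬ ∀ i j, R (f i) (g j)) :
    (BipK s t).Free (χ.labelGraph k) := by
  rintro ⟨φ⟩
  have hadj : ∀ i j, (χ.labelGraph k).Adj (φ (.inl i)) (φ (.inr j)) := fun i j =>
    φ.toHom.map_rel (by simp)
  rcases BipK.hom_aligned hs ht ((SimpleGraph.Hom.ofLE χ.labelGraph_le).comp φ.toHom) with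
    ⟨f, g, hf, hg⟩ | ⟨f, g, hf, hg⟩
  all_goals
    replace hf : ∀ i, φ (.inl i) = _ := hf
    replace hg : ∀ i, φ (.inr i) = _ := hg
    refine hfree f g (fun i i' h => ?_) (fun i i' h => ?_) fun i j => ?_
    · exact Sum.inl_injective (φ.injective (by simp [hf, h]))
    · exact Sum.inr_injective (φ.injective (by simp [hg, h]))
    · have := hadj i j
      rw [hf, hg] at this
      first
        | exact (hR _ _).1 this
        | exact hsymm _ _ ((hR _ _).1 this.symm)

/-! ### The patterns -/

/-- If the edges of colour `k` in a copy of `K_{a,N}` form a `K_{a,b}`, then at most `b` vertices on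
the side of size `N` meet colour `k`, and the remaining `N - b` span a `K_{a,N-b}` of the other
colour. The hypothesis `a ≤ b` covers the case in which the sides of `K_{a,b}` are exchanged. -/
theorem HasColoredCopy.exists_isContained {n a b N : ℕ} {χ : BipColoring n} (ha : 0 < a)
    (hab : a ≤ b) (h : HasColoredCopy χ (BipK a N) (BipK a b)) :
    ∃ k, (BipK a b).IsContained (χ.labelGraph k) ∧
      ∀ k', k ≠ k' → (BipK a (N - b)).IsContained (χ.labelGraph k') := by
  classical
  obtain ⟨φ, k, ⟨e⟩⟩ := h
  set L := (χ.pullback φ.toHom).labelGraph k with hL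
  have hLadj : ∀ x y, L.Adj x y ↔ (BipK a N).Adj x y ∧ (χ.labelGraph k).Adj (φ x) (φ y) := by
    intro x y
    rw [hL, SimpleGraph.EdgeLabeling.labelGraph_adj, SimpleGraph.EdgeLabeling.labelGraph_adj]
    constructor
    · rintro ⟨H, h⟩
      exact ⟨H, φ.toHom.map_rel H, h⟩
    · rintro ⟨H, _, h⟩
      exact ⟨H, h⟩
  have hLle : L ≤ BipK a N := fun x y h => ((hLadj x y).1 h).1
  refine ⟨k, ?_, fun k' hk => ?_⟩
  · have h1 : L.IsContained (χ.labelGraph k) :=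
      ⟨⟨⟨φ, fun {x y} h => ((hLadj x y).1 h).2⟩, φ.injective⟩⟩
    have h2 : (BipK a b).IsContained (L.induce L.support) := e.isContained'
    exact (h2.trans ⟨SimpleGraph.Copy.induce L L.support⟩).trans h1
  · let θ : BipK a b →g BipK a N :=
      (SimpleGraph.Hom.ofLE hLle).comp
        ((SimpleGraph.Copy.induce L L.support).toHom.comp e.symm.toHom)
    have hθ : ∀ x, θ x = (e.symm x : Fin a ⊕ Fin N) := fun x => rfl
    have hsurj : ∀ z ∈ L.support, ∃ x, θ x = z := fun z hz =>
      ⟨e ⟨z, hz⟩, by rw [hθ, e.symm_apply_apply]⟩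
    let U : Finset (Fin N) := Finset.univ.filter fun y => Sum.inr y ∈ L.support
    have hU : U.card ≤ b := by
      rcases BipK.hom_aligned ha (ha.trans_le hab) θ with ⟨f, g, hf, hg⟩ | ⟨f, g, hf, hg⟩
      · have : U ⊆ Finset.univ.image g := by
          intro y hy
          obtain ⟨x | x, hx⟩ := hsurj _ (Finset.mem_filter.1 hy).2
          · rw [hf] at hx
            cases hx
          · rw [hg] at hx
            exact Finset.mem_image.2 ⟨x, Finset.mem_univ _, Sum.inr_injective hx⟩
        exact (Finset.card_le_card this).trans (Finset.card_image_le.trans (by simp))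
      · have : U ⊆ Finset.univ.image f := by
          intro y hy
          obtain ⟨x | x, hx⟩ := hsurj _ (Finset.mem_filter.1 hy).2
          · rw [hf] at hx
            exact Finset.mem_image.2 ⟨x, Finset.mem_univ _, Sum.inr_injective hx⟩
          · rw [hg] at hx
            cases hx
        exact (Finset.card_le_card this).trans (Finset.card_image_le.trans (by simpa using hab))
    have hcard : N - b ≤ Uᶜ.card := by
      rw [Finset.card_compl, Fintype.card_fin]
      omega
    let g : Fin (N - b) → Fin N := fun j => Uᶜ.orderEmbOfFin rfl (Fin.castLE hcard j)
    have hg : ∀ j, g j ∉ U := fun j =>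
      Finset.mem_compl.1 (Uᶜ.orderEmbOfFin_mem rfl (Fin.castLE hcard j))
    refine BipK.isContained_of_forall_adj (fun i => φ (.inl i)) (fun j => φ (.inr (g j)))
      (φ.injective.comp Sum.inl_injective) (φ.injective.comp (Sum.inr_injective.comp
        ((Uᶜ.orderEmbOfFin rfl).injective.comp (Fin.castLE_injective hcard)))) fun i j => ?_
    refine labelGraph_adj_of_not_adj χ hk (φ.toHom.map_rel (by simp)) fun hadj => ?_
    refine hg j (Finset.mem_filter.2 ⟨Finset.mem_univ _, .inl i, ?_⟩)
    exact ((hLadj _ _).2 ⟨by simp, hadj⟩).symm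

/-- Each pattern contains, in both colours, a complete bipartite graph with parts of sizes at least
`s` and `T`. -/
theorem not_hasPattern_of_free {n s t T : ℕ} {χ : BipColoring n} (hs : 0 < s) (hsT : s ≤ T)
    (htT : t ≤ T) (h : (BipK s t).Free (χ.labelGraph .blue)) : ¬ HasPattern χ s T := by
  have hTT : ¬ (BipK T T).IsContained (χ.labelGraph .blue) := fun h' =>
    h ((BipK.isContained_of_le hsT htT).trans h')
  have hsT' : ¬ (BipK s T).IsContained (χ.labelGraph .blue) := fun h' =>
    h ((BipK.isContained_of_le le_rfl htT).trans h')
  have hTs : ¬ (BipK T s).IsContained (χ.labelGraph .blue) := fun h' =>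
    hsT' ((BipK.isContained_swap s T).trans h')
  rintro (h1 | h1)
  · obtain ⟨k, hk, hk'⟩ := h1.exists_isContained (hs.trans_le hsT) le_rfl
    rw [Nat.add_sub_cancel] at hk'
    cases k
    · exact hTs (hk' .blue (by simp))
    · exact hTT hk
  · obtain ⟨k, hk, hk'⟩ := h1.exists_isContained hs hsT
    rw [two_mul, Nat.add_sub_cancel] at hk'
    cases k
    · exact hsT' (hk' .blue (by simp))
    · exact hsT' hk

/-- A set `A` joined in colour `k` to `B` and in the other colour to `B'` gives a copy of
`K_{a,b+b'}` in which colour `k` forms a `K_{a,b}`. The sets `B` and `B'` are disjoint because `A`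
is nonempty. -/
theorem hasColoredCopy_of_finsets {n a b b' N : ℕ} {χ : BipColoring n} (ha : 0 < a) (hb : 0 < b)
    (hN : b + b' = N) {k k' : EdgeColor} (hk : k ≠ k') {A B B' : Finset (Fin n ⊕ Fin n)}
    (hA : A.card = a) (hB : B.card = b) (hB' : B'.card = b')
    (hAB : ∀ x ∈ A, ∀ y ∈ B, (χ.labelGraph k).Adj x y)
    (hAB' : ∀ x ∈ A, ∀ y ∈ B', (χ.labelGraph k').Adj x y) :
    HasColoredCopy χ (BipK a N) (BipK a b) := by
  classical
  subst hN
  let f : Fin a ↪ Fin n ⊕ Fin n := (A.equivFinOfCardEq hA).symm.toEmbedding.trans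
    (Function.Embedding.subtype _)
  let p : Fin b ↪ Fin n ⊕ Fin n := (B.equivFinOfCardEq hB).symm.toEmbedding.trans
    (Function.Embedding.subtype _)
  let p' : Fin b' ↪ Fin n ⊕ Fin n := (B'.equivFinOfCardEq hB').symm.toEmbedding.trans
    (Function.Embedding.subtype _)
  have hf : ∀ i, f i ∈ A := fun i => ((A.equivFinOfCardEq hA).symm i).2
  have hp : ∀ i, p i ∈ B := fun i => ((B.equivFinOfCardEq hB).symm i).2
  have hp' : ∀ i, p' i ∈ B' := fun i => ((B'.equivFinOfCardEq hB').symm i).2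
  let g : Fin (b + b') → Fin n ⊕ Fin n := Fin.append p p'
  have hgadj : ∀ i j, (BipK n n).Adj (f i) (g j) := by
    intro i j
    induction j using Fin.addCases with
    | left j => simpa [g] using χ.labelGraph_le (hAB _ (hf i) _ (hp j))
    | right j => simpa [g] using χ.labelGraph_le (hAB' _ (hf i) _ (hp' j))
  have hginj : Function.Injective g := by
    refine Fin.append_injective_iff.2 ⟨p.injective, p'.injective, fun i j h => ?_⟩
    have h1 := hAB _ (hf ⟨0, ha⟩) _ (hp i)
    have h2 := hAB' _ (hf ⟨0, ha⟩) _ (hp' j)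
    rw [h] at h1
    exact not_labelGraph_adj_of_adj χ hk h1 h2
  let φ : SimpleGraph.Copy (BipK a (b + b')) (BipK n n) :=
    ⟨⟨Sum.elim f g, by
      rintro (i | i) (j | j) hij
      · simp at hij
      · exact hgadj i j
      · exact (hgadj j i).symm
      · simp at hij⟩, f.injective.sumElim hginj fun i j => (hgadj i j).ne⟩
  refine ⟨φ, k, ?_⟩
  set L := (χ.pullback φ.toHom).labelGraph k with hL
  have hLadj : ∀ x y, L.Adj x y ↔
      (BipK a (b + b')).Adj x y ∧ (χ.labelGraph k).Adj (φ x) (φ y) := by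
    intro x y
    rw [hL, SimpleGraph.EdgeLabeling.labelGraph_adj, SimpleGraph.EdgeLabeling.labelGraph_adj]
    constructor
    · rintro ⟨H, h⟩
      exact ⟨H, φ.toHom.map_rel H, h⟩
    · rintro ⟨H, _, h⟩
      exact ⟨H, h⟩
  have hφl : ∀ i, φ (.inl i) = f i := fun i => rfl
  have hφr : ∀ j, φ (.inr j) = g j := fun j => rfl
  have hLl : ∀ i j, L.Adj (.inl i) (.inr (Fin.castAdd b' j)) := by
    intro i j
    rw [hLadj, hφl, hφr]
    refine ⟨by simp, ?_⟩
    simpa [g] using hAB _ (hf i) _ (hp j)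
  have hLr : ∀ x j, ¬ L.Adj x (.inr (Fin.natAdd b j)) := by
    rintro (i | i) j h
    · rw [hLadj, hφl, hφr] at h
      have h2 := h.2
      simp only [g, Fin.append_right] at h2
      exact not_labelGraph_adj_of_adj χ hk h2 (hAB' _ (hf i) _ (hp' j))
    · have := ((hLadj _ _).1 h).1
      simp at this
  let ψ : Fin a ⊕ Fin b → Fin a ⊕ Fin (b + b') := Sum.map id (Fin.castAdd b')
  have hψ : Function.Injective ψ :=
    Sum.map_injective.2 ⟨Function.injective_id, Fin.castAdd_injective b b'⟩
  have hsupp : L.support = Set.range ψ := by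
    ext z
    constructor
    · rintro ⟨w, hw⟩
      rcases z with i | j
      · exact ⟨.inl i, rfl⟩
      · induction j using Fin.addCases with
        | left j => exact ⟨.inr j, rfl⟩
        | right j => exact absurd hw.symm (hLr _ _)
    · rintro ⟨i | j, rfl⟩
      · exact ⟨_, hLl i ⟨0, hb⟩⟩
      · exact ⟨_, (hLl ⟨0, ha⟩ j).symm⟩
  unfold EdgesForm
  rw [hsupp]
  refine ⟨SimpleGraph.Iso.symm ⟨Equiv.ofInjective ψ hψ, ?_⟩⟩
  rintro (i | i) (j | j)
  · refine iff_of_false (fun h => ?_) (by simp)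
    have := ((hLadj _ _).1 h).1
    simp [ψ] at this
  · exact iff_of_true (hLl i j) (by simp)
  · exact iff_of_true (hLl j i).symm (by simp)
  · refine iff_of_false (fun h => ?_) (by simp)
    have := ((hLadj _ _).1 h).1
    simp [ψ] at this

/-! ### Every colouring with many edges of both colours contains a pattern -/

open Classical in
theorem sum_choose_card_filter_eq {n : ℕ} (R : Fin n → Fin n → Prop) (s : ℕ) :
    ∑ y, (Finset.univ.filter fun x => R x y).card.choose s =
      ∑ S ∈ Finset.powersetCard s (Finset.univ : Finset (Fin n)),
        (Finset.univ.filter fun y => ∀ x ∈ S, R x y).card := by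
  refine Eq.trans (Finset.sum_congr rfl fun y _ => ?_)
    (Finset.sum_card_bipartiteAbove_eq_sum_card_bipartiteBelow fun y S => ∀ x ∈ S, R x y)
  rw [← Finset.card_powersetCard]
  congr 1
  ext S
  simp [Finset.mem_bipartiteAbove, Finset.subset_iff, and_comm]

open Classical in
/-- Counting the pairs of a vertex `y` and `s` ordered distinct neighbours of `y`. For a degree below
`s` the truncated subtraction makes the term vanish, as it should. -/
theorem sum_pow_le_of_forall_card_le {n s M : ℕ} (R : Fin n → Fin n → Prop)
    (h : ∀ S : Finset (Fin n), S.card = s →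
      (Finset.univ.filter fun y => ∀ x ∈ S, R x y).card ≤ M) :
    ∑ y, ((Finset.univ.filter fun x => R x y).card + 1 - s) ^ s ≤ n ^ s * M := by
  calc ∑ y, ((Finset.univ.filter fun x => R x y).card + 1 - s) ^ s
      ≤ ∑ y, (Finset.univ.filter fun x => R x y).card.descFactorial s :=
        Finset.sum_le_sum fun y _ => Nat.pow_sub_le_descFactorial _ _
    _ = s.factorial * ∑ S ∈ Finset.powersetCard s (Finset.univ : Finset (Fin n)),
        (Finset.univ.filter fun y => ∀ x ∈ S, R x y).card := by
      rw [← sum_choose_card_filter_eq, Finset.mul_sum]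
      exact Finset.sum_congr rfl fun y _ => Nat.descFactorial_eq_factorial_mul_choose _ _
    _ ≤ s.factorial * (n.choose s * M) := by
      refine Nat.mul_le_mul_left _ ((Finset.sum_le_card_nsmul _ _ M fun S hS =>
        h S (Finset.mem_powersetCard.1 hS).2).trans_eq ?_)
      simp
    _ = n.descFactorial s * M := by
      rw [Nat.descFactorial_eq_factorial_mul_choose, mul_assoc]
    _ ≤ n ^ s * M := Nat.mul_le_mul_right _ (Nat.descFactorial_le_pow _ _)

theorem rpow_two_sub_inv_pow {s : ℕ} (hs : 1 ≤ s) {x : ℝ} (hx : 0 ≤ x) :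
    (x ^ (2 - 1 / (s : ℝ))) ^ s = x ^ (2 * s - 1) := by
  have hs' : (s : ℝ) ≠ 0 := by positivity
  rw [← Real.rpow_natCast, ← Real.rpow_mul hx, ← Real.rpow_natCast, Nat.cast_sub (by omega)]
  congr 1
  push_cast
  field_simp

theorem one_le_two_sub_inv {s : ℕ} (hs : 1 ≤ s) : (1 : ℝ) ≤ 2 - 1 / (s : ℝ) := by
  have : 1 / (s : ℝ) ≤ 1 := by
    rw [div_le_one (by positivity)]
    exact_mod_cast hs
  linarith

/-- The Kővári–Sós–Turán theorem for bipartite graphs, with control over the side on which the part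
of size `s` lies. -/
theorem exists_biclique_of_le_ncard {n s : ℕ} (hs : 1 ≤ s) (hn : 1 ≤ n) (M : ℕ)
    (R : Fin n → Fin n → Prop)
    (hR : ((s + M + 1 : ℕ) : ℝ) * (n : ℝ) ^ (2 - 1 / (s : ℝ)) ≤
      ({e : Fin n × Fin n | R e.1 e.2}.ncard : ℝ)) :
    ∃ S Y : Finset (Fin n), S.card = s ∧ Y.card = M ∧ ∀ x ∈ S, ∀ y ∈ Y, R x y := by
  classical
  by_contra! hcon
  have h : ∀ S : Finset (Fin n), S.card = s →
      (Finset.univ.filter fun y => ∀ x ∈ S, R x y).card ≤ M := by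
    intro S hS
    by_contra! hlt
    obtain ⟨Y, hY, hYM⟩ := Finset.exists_subset_card_eq hlt.le
    obtain ⟨x, hx, y, hy, hxy⟩ := hcon S Y hS hYM
    exact hxy ((Finset.mem_filter.1 (hY hy)).2 x hx)
  have h1 := sum_pow_le_of_forall_card_le R h
  set D : Fin n → ℕ := fun y => (Finset.univ.filter fun x => R x y).card + 1 - s with hD
  have hE : {e : Fin n × Fin n | R e.1 e.2}.ncard ≤ ∑ y, D y + n * s := by
    have h2 : {e : Fin n × Fin n | R e.1 e.2}.ncard =
        ∑ y, (Finset.univ.filter fun x => R x y).card := by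
      rw [Set.ncard_eq_toFinset_card', Set.toFinset_ofPred,
        Finset.card_eq_sum_card_fiberwise (f := Prod.snd) (t := Finset.univ) (by simp)]
      refine Finset.sum_congr rfl fun y _ => ?_
      refine Finset.card_bij' (fun e _ => e.1) (fun x _ => (x, y)) ?_ ?_ ?_ ?_ <;> aesop
    rw [h2]
    calc _ ≤ ∑ y, (D y + s) := Finset.sum_le_sum fun y _ => by simp only [hD]; omega
      _ = _ := by simp [Finset.sum_add_distrib]
  obtain ⟨m, rfl⟩ : ∃ m, s = m + 1 := ⟨s - 1, by omega⟩
  set w : ℝ := (n : ℝ) ^ (2 - 1 / ((m + 1 : ℕ) : ℝ)) with hw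
  have hn' : (1 : ℝ) ≤ n := by exact_mod_cast hn
  have hw1 : (n : ℝ) ≤ w := by
    have := Real.rpow_le_rpow_of_exponent_le hn' (one_le_two_sub_inv hs)
    rwa [Real.rpow_one] at this
  have hw0 : 0 < w := by positivity
  have hwpow : w ^ (m + 1) = (n : ℝ) ^ m * (n : ℝ) ^ (m + 1) := by
    rw [hw, rpow_two_sub_inv_pow hs (by positivity), ← pow_add]
    congr 1
    omega
  have hDw : ((M : ℝ) + 1) * w ≤ ∑ y, (D y : ℝ) := by
    have h3 : ({e : Fin n × Fin n | R e.1 e.2}.ncard : ℝ) ≤ ∑ y, (D y : ℝ) + n * (m + 1) := by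
      exact_mod_cast hE
    have h4 := hR.trans h3
    push_cast at h4
    have : (n : ℝ) * (m + 1) ≤ w * (m + 1) := by gcongr
    linarith
  -- The power mean inequality turns the bound on the `s`-th powers into one on the edges.
  have hpm := pow_sum_div_card_le_sum_pow (s := Finset.univ) (f := fun y => (D y : ℝ))
    (fun y _ => Nat.cast_nonneg _) m
  rw [Finset.card_univ, Fintype.card_fin, div_le_iff₀ (by positivity)] at hpm
  have h5 : ∑ y, (D y : ℝ) ^ (m + 1) ≤ (n : ℝ) ^ (m + 1) * M := by exact_mod_cast h1
  have h6 : (((M : ℝ) + 1) * w) ^ (m + 1) ≤ w ^ (m + 1) * M := by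
    calc (((M : ℝ) + 1) * w) ^ (m + 1) ≤ (∑ y, (D y : ℝ)) ^ (m + 1) := by gcongr
      _ ≤ _ := hpm
      _ ≤ ((n : ℝ) ^ (m + 1) * M) * (n : ℝ) ^ m := by gcongr
      _ = _ := by rw [hwpow]; ring
  rw [mul_pow, mul_comm] at h6
  have h7 := le_of_mul_le_mul_left h6 (by positivity)
  have h8 : (M : ℝ) + 1 ≤ ((M : ℝ) + 1) ^ (m + 1) :=
    le_self_pow₀ (by linarith [Nat.cast_nonneg (α := ℝ) M]) (Nat.succ_ne_zero m)
  linarith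

/-- Given a `K_{s,M}` of colour `k` with parts `S` and `Y`, only boundedly many vertices `x` send
`T` edges of the other colour to `Y`: otherwise `T` of them share their `T` neighbours, and together
with `S` they form a pattern of the first kind. -/
theorem hasPattern_or_card_le {n s T M : ℕ} (hT : 1 ≤ T) {χ : BipColoring n}
    {k k' : EdgeColor} (hk : k ≠ k') {S Y : Finset (Fin n)} (hS : S.card = s) (hY : Y.card = M)
    (hSY : ∀ x ∈ S, ∀ y ∈ Y, (χ.labelGraph k).Adj (.inl x) (.inr y)) (Z : Finset (Fin n))
    (hZ : ∀ x ∈ Z, ∃ A ⊆ Y, A.card = T ∧ ∀ y ∈ A, (χ.labelGraph k').Adj (.inl x) (.inr y)) :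
    HasPattern χ s T ∨ Z.card ≤ M.choose T * T := by
  classical
  refine or_iff_not_imp_right.2 fun hcard => ?_
  choose! A hAY hAT hA using hZ
  obtain ⟨A₀, hA₀, hlt⟩ := Finset.exists_lt_card_fiber_of_mul_lt_card_of_maps_to
    (s := Z) (t := Finset.powersetCard T Y) (f := A) (n := T)
    (fun x hx => Finset.mem_powersetCard.2 ⟨hAY x hx, hAT x hx⟩)
    (by rw [Finset.card_powersetCard, hY]; exact not_le.1 hcard)
  obtain ⟨B, hB, hBT⟩ := Finset.exists_subset_card_eq hlt.le
  obtain ⟨hA₀Y, hA₀T⟩ := Finset.mem_powersetCard.1 hA₀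
  refine .inl (hasColoredCopy_of_finsets (A := A₀.map .inr) (B := B.map .inl)
    (B' := S.map .inl) hT hT (add_comm T s) hk.symm (by simpa) (by simpa) (by simpa) ?_ ?_)
  · simp only [Finset.mem_map, Function.Embedding.inr_apply, Function.Embedding.inl_apply]
    rintro _ ⟨y, hy, rfl⟩ _ ⟨x, hx, rfl⟩
    obtain ⟨hxZ, rfl⟩ := Finset.mem_filter.1 (hB hx)
    exact (hA x hxZ y hy).symm
  · simp only [Finset.mem_map, Function.Embedding.inr_apply, Function.Embedding.inl_apply]
    rintro _ ⟨y, hy, rfl⟩ _ ⟨x, hx, rfl⟩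
    exact (hSY x hx y (hA₀Y hy)).symm

/-- With a `K_{s,2T}` in each colour, almost every vertex sends `T` blue edges into the blue one and
`T` red edges into the red one, unless there is a pattern of the first kind. By pigeonhole, `s`
such vertices share these neighbours and form a pattern of the second kind. -/
theorem hasPattern_of_bicliques {n s T : ℕ} (hs : 1 ≤ s) (hT : 1 ≤ T) {χ : BipColoring n}
    (hn : (2 * T).choose T * T + (2 * T).choose T * T +
      (2 * T).choose T * (2 * T).choose T * s ≤ n)
    (h : ∀ k, ∃ S Y : Finset (Fin n), S.card = s ∧ Y.card = 2 * T ∧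
      ∀ x ∈ S, ∀ y ∈ Y, (χ.labelGraph k).Adj (.inl x) (.inr y)) :
    HasPattern χ s T := by
  classical
  by_contra hno
  -- `P Y k x`: the vertex `x` sends `T` edges of colour `k` to `Y`.
  let P : Finset (Fin n) → EdgeColor → Fin n → Prop := fun Y k x =>
    ∃ A ⊆ Y, A.card = T ∧ ∀ y ∈ A, (χ.labelGraph k).Adj (.inl x) (.inr y)
  have hP : ∀ (Y : Finset (Fin n)) k k', k ≠ k' → Y.card = 2 * T → ∀ x, ¬ P Y k' x → P Y k x := by
    intro Y k k' hk hY x hx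
    let W := Y.filter fun y => (χ.labelGraph k').Adj (.inl x) (.inr y)
    have hW : W.card < T := by
      by_contra! hle
      obtain ⟨A, hA, hAT⟩ := Finset.exists_subset_card_eq hle
      exact hx ⟨A, hA.trans (Finset.filter_subset _ _), hAT,
        fun y hy => (Finset.mem_filter.1 (hA hy)).2⟩
    have hle : T ≤ (Y \ W).card := by
      rw [Finset.card_sdiff_of_subset (show W ⊆ Y from Finset.filter_subset _ _)]
      omega
    obtain ⟨A, hA, hAT⟩ := Finset.exists_subset_card_eq hle
    refine ⟨A, hA.trans Finset.sdiff_subset, hAT, fun y hy => ?_⟩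
    obtain ⟨hyY, hyW⟩ := Finset.mem_sdiff.1 (hA hy)
    exact labelGraph_adj_of_not_adj χ hk.symm (by simp) fun hadj =>
      hyW (Finset.mem_filter.2 ⟨hyY, hadj⟩)
  obtain ⟨S₁, Y₁, hS₁, hY₁, h₁⟩ := h .blue
  obtain ⟨S₂, Y₂, hS₂, hY₂, h₂⟩ := h .red
  let Z₁ := Finset.univ.filter fun x => P Y₁ .red x
  let Z₂ := Finset.univ.filter fun x => P Y₂ .blue x
  have hZ₁ : Z₁.card ≤ (2 * T).choose T * T :=
    (hasPattern_or_card_le hT (by simp) hS₁ hY₁ h₁ Z₁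
      fun x hx => (Finset.mem_filter.1 hx).2).resolve_left hno
  have hZ₂ : Z₂.card ≤ (2 * T).choose T * T :=
    (hasPattern_or_card_le hT (by simp) hS₂ hY₂ h₂ Z₂
      fun x hx => (Finset.mem_filter.1 hx).2).resolve_left hno
  let G := (Z₁ ∪ Z₂)ᶜ
  have hG : (2 * T).choose T * (2 * T).choose T * s ≤ G.card := by
    have := Finset.card_union_le Z₁ Z₂
    rw [Finset.card_compl, Fintype.card_fin]
    omega
  have hG₁ : ∀ x ∈ G, P Y₁ .blue x := fun x hx =>
    hP Y₁ _ .red (by simp) hY₁ x fun h' => Finset.mem_compl.1 hx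
      (Finset.mem_union_left _ (Finset.mem_filter.2 ⟨Finset.mem_univ _, h'⟩))
  have hG₂ : ∀ x ∈ G, P Y₂ .red x := fun x hx =>
    hP Y₂ _ .blue (by simp) hY₂ x fun h' => Finset.mem_compl.1 hx
      (Finset.mem_union_right _ (Finset.mem_filter.2 ⟨Finset.mem_univ _, h'⟩))
  choose! A₁ hA₁Y hA₁T hA₁ using hG₁
  choose! A₂ hA₂Y hA₂T hA₂ using hG₂
  have hne : (Finset.powersetCard T Y₁ ×ˢ Finset.powersetCard T Y₂).Nonempty := by
    rw [← Finset.card_pos, Finset.card_product, Finset.card_powersetCard,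
      Finset.card_powersetCard, hY₁, hY₂]
    have : 0 < (2 * T).choose T := Nat.choose_pos (by omega)
    positivity
  obtain ⟨⟨B₁, B₂⟩, hB, hle⟩ := Finset.exists_le_card_fiber_of_mul_le_card_of_maps_to
    (s := G) (t := Finset.powersetCard T Y₁ ×ˢ Finset.powersetCard T Y₂)
    (f := fun x => (A₁ x, A₂ x)) (n := s)
    (fun x hx => Finset.mem_product.2 ⟨Finset.mem_powersetCard.2 ⟨hA₁Y x hx, hA₁T x hx⟩,
      Finset.mem_powersetCard.2 ⟨hA₂Y x hx, hA₂T x hx⟩⟩) hne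
    (by rwa [Finset.card_product, Finset.card_powersetCard, Finset.card_powersetCard, hY₁, hY₂])
  obtain ⟨A, hA, hAs⟩ := Finset.exists_subset_card_eq hle
  obtain ⟨hB₁, hB₂⟩ := Finset.mem_product.1 hB
  refine hno (.inr (hasColoredCopy_of_finsets (A := A.map .inl) (B := B₁.map .inr)
    (B' := B₂.map .inr) hs hT (two_mul T).symm (show EdgeColor.blue ≠ EdgeColor.red by simp)
    (by simpa) (by simpa using (Finset.mem_powersetCard.1 hB₁).2)
    (by simpa using (Finset.mem_powersetCard.1 hB₂).2) ?_ ?_))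
  all_goals
    simp only [Finset.mem_map, Function.Embedding.inr_apply, Function.Embedding.inl_apply]
    rintro _ ⟨x, hx, rfl⟩ _ ⟨y, hy, rfl⟩
    obtain ⟨hxG, hxB⟩ := Finset.mem_filter.1 (hA hx)
    simp only [Prod.mk.injEq] at hxB
    obtain ⟨rfl, rfl⟩ := hxB
  · exact hA₁ x hxG y hy
  · exact hA₂ x hxG y hy

theorem exists_forall_hasPattern {s T : ℕ} (hs : 1 ≤ s) (hT : 1 ≤ T) :
    ∃ C : ℝ, 0 < C ∧ ∃ N : ℕ, ∀ n ≥ N, ∀ χ : BipColoring n,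
      (∀ k, C * (n : ℝ) ^ (2 - 1 / (s : ℝ)) ≤ colorCount χ k) → HasPattern χ s T := by
  refine ⟨((s + 2 * T + 1 : ℕ) : ℝ), by positivity,
    (2 * T).choose T * T + (2 * T).choose T * T + (2 * T).choose T * (2 * T).choose T * s + 1,
    fun n hn χ hχ => ?_⟩
  refine hasPattern_of_bicliques hs hT (by omega) fun k => ?_
  have := hχ k
  rw [colorCount_eq_ncard] at this
  exact exists_biclique_of_le_ncard hs (by omega) (2 * T)
    (fun x y => (χ.labelGraph k).Adj (.inl x) (.inr y)) this

/-! ### Dense graphs without a complete bipartite subgraph -/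

theorem exists_dense_symm_rel_one {t : ℕ} (ht : 2 ≤ t) (n : ℕ) :
    ∃ R : Fin n → Fin n → Prop, (∀ x y, R x y → R y x) ∧
      (∀ (f : Fin 1 → Fin n) (g : Fin t → Fin n), Function.Injective f → Function.Injective g →
        ¬ ∀ i j, R (f i) (g j)) ∧
      {e : Fin n × Fin n | R e.1 e.2}.ncard = n := by
  refine ⟨Eq, fun _ _ => Eq.symm, fun f g _ hg h => ?_, ?_⟩
  · have := hg ((h 0 ⟨0, by omega⟩).symm.trans (h 0 ⟨1, by omega⟩))
    simp at this
  · have : {e : Fin n × Fin n | e.1 = e.2} = (fun x => (x, x)) '' Set.univ := by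
      ext ⟨x, y⟩
      simp
    rw [this, Set.ncard_image_of_injective _ fun x y h => (Prod.ext_iff.1 h).1]
    simp

/-- The projective norm graph of `GaloisField p m` over its prime field, placed on `n` vertices by
adding isolated ones. -/
theorem exists_normAdj_rel {m p n t : ℕ} (hm : m ≠ 0) (hp : p.Prime) (hn : p ^ (m + 1) ≤ n)
    (ht : m.factorial + 1 ≤ t) :
    ∃ R : Fin n → Fin n → Prop, (∀ x y, R x y → R y x) ∧
      (∀ (f : Fin (m + 1) → Fin n) (g : Fin t → Fin n), Function.Injective f →
        Function.Injective g → ¬ ∀ i j, R (f i) (g j)) ∧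
      p ^ (2 * m + 1) ≤ 4 * {e : Fin n × Fin n | R e.1 e.2}.ncard ∧
      {e : Fin n × Fin n | R e.1 e.2}.ncard ≤ p ^ (2 * m + 1) := by
  classical
  have := Fact.mk hp
  let F := ZMod p
  let K := GaloisField p m
  have hfr : Module.finrank F K = m := GaloisField.finrank p hm
  have hK : Nat.card K = p ^ m := GaloisField.card p m hm
  have : Finite K := Nat.finite_of_card_ne_zero (by rw [hK]; exact pow_ne_zero _ hp.ne_zero)
  have hFu : Nat.card Fˣ = p - 1 := by
    rw [Nat.card_units, Nat.card_zmod]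
  have hKu : Nat.card Kˣ = p ^ m - 1 := by
    rw [Nat.card_units, hK]
  have hV : Nat.card (K × Fˣ) ≤ n := by
    rw [Nat.card_prod, hK, hFu]
    calc p ^ m * (p - 1) ≤ p ^ m * p := Nat.mul_le_mul_left _ (Nat.sub_le _ _)
      _ ≤ n := by rwa [← pow_succ]
  have := Fintype.ofFinite (K × Fˣ)
  obtain ⟨e⟩ : Nonempty ((K × Fˣ) ↪ Fin n) :=
    Function.Embedding.nonempty_of_card_le (by simpa [Nat.card_eq_fintype_card] using hV)
  let R : Fin n → Fin n → Prop := fun x y => ∃ v w, e v = x ∧ e w = y ∧ NormAdj F K v w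
  have hcard : {e : Fin n × Fin n | R e.1 e.2}.ncard =
      {e : (K × Fˣ) × (K × Fˣ) | NormAdj F K e.1 e.2}.ncard := by
    rw [← Set.ncard_image_of_injective _ (e.injective.prodMap e.injective)]
    congr 1
    ext ⟨x, y⟩
    constructor
    · rintro ⟨v, w, rfl, rfl, h⟩
      exact ⟨(v, w), h, rfl⟩
    · rintro ⟨⟨v, w⟩, h, h'⟩
      obtain ⟨rfl, rfl⟩ := Prod.mk.injEq .. ▸ h'
      exact ⟨v, w, rfl, rfl, h⟩
  refine ⟨R, ?_, ?_, ?_, ?_⟩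
  · rintro x y ⟨v, w, rfl, rfl, h⟩
    exact ⟨w, v, rfl, rfl, h.symm⟩
  · intro f g hf hg h
    have hvex : ∀ i, ∃ v, e v = f i := fun i => by
      obtain ⟨v, -, hv, -⟩ := h i ⟨0, by omega⟩
      exact ⟨v, hv⟩
    have hwex : ∀ j, ∃ w, e w = g j := fun j => by
      obtain ⟨-, w, -, hw, -⟩ := h 0 j
      exact ⟨w, hw⟩
    choose v hv using hvex
    choose w hw using hwex
    have hvi : Function.Injective v := fun i i' hii => hf (by rw [← hv, ← hv, hii])
    have hwi : Function.Injective w := fun i i' hii => hg (by rw [← hw, ← hw, hii])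
    have hadj : ∀ i j, NormAdj F K (v i) (w j) := by
      intro i j
      obtain ⟨v', w', hv', hw', h'⟩ := h i j
      rw [← hv] at hv'
      rw [← hw] at hw'
      rwa [e.injective hv', e.injective hw'] at h'
    have hle := card_common_normAdj_le hfr v hvi (Finset.univ.image w) (by
      intro x hx i
      obtain ⟨j, -, rfl⟩ := Finset.mem_image.1 hx
      exact hadj i j)
    rw [Finset.card_image_of_injective _ hwi, Finset.card_univ, Fintype.card_fin] at hle
    omega
  · rw [hcard]
    have h1 := le_ncard_normAdj F K
    rw [hK, hFu, hKu] at h1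
    have h2 : p ≤ 2 * (p - 1) := by have := hp.two_le; omega
    have h3 : p ^ m ≤ 2 * (p ^ m - 1) := by
      have : p ≤ p ^ m := Nat.le_self_pow hm p
      have := hp.two_le
      omega
    calc p ^ (2 * m + 1) = p ^ m * p * p ^ m := by ring
      _ ≤ p ^ m * (2 * (p - 1)) * (2 * (p ^ m - 1)) := by gcongr
      _ = 4 * (p ^ m * (p - 1) * (p ^ m - 1)) := by ring
      _ ≤ _ := by gcongr
  · rw [hcard]
    have h1 := ncard_normAdj_le F K
    rw [hK, hFu] at h1
    calc _ ≤ _ := h1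
      _ ≤ p ^ m * p * p ^ m := by gcongr; exact Nat.sub_le _ _
      _ = _ := by ring

/-- Bertrand's postulate supplies a prime `p` with `n ^ (1 / s) / 2 ≤ p ≤ n ^ (1 / s)`, so that
restricting to the orders of projective norm graphs costs only a constant factor. -/
theorem exists_dense_symm_rel {s t : ℕ} (hs : 1 ≤ s) (ht : (s - 1).factorial + 1 ≤ t) :
    ∃ c : ℝ, 0 < c ∧ ∀ n : ℕ, 2 ^ s ≤ n →
      ∃ R : Fin n → Fin n → Prop, (∀ x y, R x y → R y x) ∧
      (∀ (f : Fin s → Fin n) (g : Fin t → Fin n), Function.Injective f →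
        Function.Injective g → ¬ ∀ i j, R (f i) (g j)) ∧
      c * (n : ℝ) ^ (2 - 1 / (s : ℝ)) ≤ ({e : Fin n × Fin n | R e.1 e.2}.ncard : ℝ) ∧
      ({e : Fin n × Fin n | R e.1 e.2}.ncard : ℝ) ≤ (n : ℝ) ^ (2 - 1 / (s : ℝ)) := by
  obtain ⟨m, rfl⟩ : ∃ m, s = m + 1 := ⟨s - 1, by omega⟩
  rw [Nat.add_sub_cancel] at ht
  rcases eq_or_ne m 0 with rfl | hm
  · refine ⟨1, one_pos, fun n _ => ?_⟩
    obtain ⟨R, hsymm, hfree, hcard⟩ := exists_dense_symm_rel_one (by simpa using ht) n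
    refine ⟨R, hsymm, hfree, ?_⟩
    rw [hcard]
    norm_num
  refine ⟨1 / (4 * 2 ^ (2 * m + 1)), by positivity, fun n hn => ?_⟩
  set x : ℝ := (n : ℝ) ^ (1 / ((m + 1 : ℕ) : ℝ)) with hx
  have hx0 : 0 ≤ x := by positivity
  have hxs : x ^ (m + 1) = n := by
    rw [hx, one_div, Real.rpow_inv_natCast_pow (Nat.cast_nonneg _) (Nat.succ_ne_zero m)]
  have hxe : x ^ (2 * m + 1) = (n : ℝ) ^ (2 - 1 / ((m + 1 : ℕ) : ℝ)) := by
    rw [hx, ← Real.rpow_natCast, ← Real.rpow_mul (Nat.cast_nonneg _)]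
    congr 1
    push_cast
    field_simp
    ring
  have hx2 : 2 ≤ x := by
    refine le_of_pow_le_pow_left₀ (Nat.succ_ne_zero m) hx0 ?_
    rw [hxs]
    exact_mod_cast hn
  have hu : ⌊x / 2⌋₊ ≠ 0 := by
    rw [← Nat.pos_iff_ne_zero, Nat.floor_pos]
    linarith
  obtain ⟨p, hp, hup, hpu⟩ := Nat.exists_prime_lt_and_le_two_mul _ hu
  have hpx : (p : ℝ) ≤ x := by
    have h1 : (p : ℝ) ≤ 2 * (⌊x / 2⌋₊ : ℝ) := by exact_mod_cast hpu
    have h2 := Nat.floor_le (show 0 ≤ x / 2 by positivity)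
    linarith
  have hxp : x / 2 ≤ p := (Nat.lt_of_floor_lt hup).le
  have hpn : p ^ (m + 1) ≤ n := by
    have : (p : ℝ) ^ (m + 1) ≤ n := by
      rw [← hxs]
      gcongr
    exact_mod_cast this
  obtain ⟨R, hsymm, hfree, hlow, hup'⟩ := exists_normAdj_rel hm hp hpn ht
  refine ⟨R, hsymm, hfree, ?_, ?_⟩
  · have h1 : (p : ℝ) ^ (2 * m + 1) ≤ 4 * ({e : Fin n × Fin n | R e.1 e.2}.ncard : ℝ) := by
      exact_mod_cast hlow
    have h2 : (x / 2) ^ (2 * m + 1) ≤ (p : ℝ) ^ (2 * m + 1) := by gcongr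
    rw [← hxe]
    calc 1 / (4 * 2 ^ (2 * m + 1)) * x ^ (2 * m + 1) = (x / 2) ^ (2 * m + 1) / 4 := by
          rw [div_pow]
          field_simp
      _ ≤ _ := by linarith
  · rw [← hxe]
    calc _ ≤ (p : ℝ) ^ (2 * m + 1) := by exact_mod_cast hup'
      _ ≤ _ := by gcongr

theorem exists_free_coloring {s t : ℕ} (hs : 1 ≤ s) (ht : (s - 1).factorial + 1 ≤ t) :
    ∃ c : ℝ, 0 < c ∧ ∀ n : ℕ, 2 ^ s ≤ n → ∃ χ : BipColoring n,
      c * (n : ℝ) ^ (2 - 1 / (s : ℝ)) ≤ (colorCount χ .blue : ℝ) ∧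
      (colorCount χ .blue : ℝ) ≤ (n : ℝ) ^ (2 - 1 / (s : ℝ)) ∧
      c * (n : ℝ) ^ (2 - 1 / (s : ℝ)) ≤ (colorCount χ .red : ℝ) ∧
      (BipK s t).Free (χ.labelGraph .blue) := by
  obtain ⟨c, hc, h⟩ := exists_dense_symm_rel hs ht
  refine ⟨min c 1, lt_min hc one_pos, fun n hn => ?_⟩
  obtain ⟨R, hsymm, hfree, hlow, hup⟩ := h n hn
  obtain ⟨χ, hχ⟩ := exists_coloring_blue_iff R
  have hblue : colorCount χ .blue = {e : Fin n × Fin n | R e.1 e.2}.ncard := by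
    rw [colorCount_eq_ncard]
    simp only [hχ]
  have hn0 : (0 : ℝ) < n := by
    have : 0 < n := (pow_pos two_pos s).trans_le hn
    exact_mod_cast this
  set w : ℝ := (n : ℝ) ^ (2 - 1 / (s : ℝ)) with hw
  have hw0 : 0 < w := by positivity
  -- Blue takes at most half of the edges, so red has at least as many.
  have hsq : 2 * w ≤ (n : ℝ) ^ 2 := by
    have h1 : (2 : ℝ) ≤ (n : ℝ) ^ (1 / (s : ℝ)) := by
      rw [one_div, Real.le_rpow_inv_iff_of_pos (by norm_num) hn0.le (by positivity),
        Real.rpow_natCast]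
      exact_mod_cast hn
    calc 2 * w ≤ (n : ℝ) ^ (1 / (s : ℝ)) * w := by gcongr
      _ = (n : ℝ) ^ 2 := by
        rw [hw, ← Real.rpow_add hn0, add_sub_cancel, Real.rpow_two]
  have hsum : (colorCount χ .red : ℝ) + colorCount χ .blue = (n : ℝ) ^ 2 := by
    exact_mod_cast colorCount_red_add_blue χ
  rw [← hblue] at hlow hup
  refine ⟨χ, ?_, hup, ?_, BipK.free_labelGraph hs (by omega) hχ hsymm hfree⟩
  · exact (mul_le_mul_of_nonneg_right (min_le_left _ _) hw0.le).trans hlow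
  · have := mul_le_mul_of_nonneg_right (min_le_right c 1) hw0.le
    linarith

theorem zTwo_isTheta {s T : ℕ} (hs : 1 ≤ s) (hT : 1 ≤ T) {c : ℝ} (hc : 0 < c) {N : ℕ}
    (h : ∀ n ≥ N, ∃ χ : BipColoring n, (∀ k, c * (n : ℝ) ^ (2 - 1 / (s : ℝ)) ≤ colorCount χ k) ∧
      ¬ HasPattern χ s T) :
    (fun n : ℕ => (zTwo n s T : ℝ)) =Θ[atTop] fun n : ℕ => (n : ℝ) ^ (2 - 1 / (s : ℝ)) := by
  obtain ⟨C, hC, N', hN'⟩ := exists_forall_hasPattern hs hT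
  refine ⟨IsBigO.of_bound (C + 1) ?_, IsBigO.of_bound c⁻¹ ?_⟩
  · filter_upwards [eventually_ge_atTop N', eventually_ge_atTop 1] with n hn hn1
    have hn1' : (1 : ℝ) ≤ n := by exact_mod_cast hn1
    have hw : 1 ≤ (n : ℝ) ^ (2 - 1 / (s : ℝ)) :=
      Real.one_le_rpow hn1' (by linarith [one_le_two_sub_inv hs])
    set w : ℝ := (n : ℝ) ^ (2 - 1 / (s : ℝ)) with hw'
    rw [Real.norm_of_nonneg (by positivity), Real.norm_of_nonneg (by positivity)]
    have hz : ForcesPattern n s T ⌈C * w⌉₊ :=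
      ⟨Nat.ceil_pos.2 (by positivity), fun χ hχ => hN' n hn χ fun k =>
        (Nat.le_ceil _).trans (by exact_mod_cast hχ k)⟩
    have h1 : (zTwo n s T : ℝ) ≤ (⌈C * w⌉₊ : ℝ) := by
      exact_mod_cast (zTwo_isLeast n s T).2 hz
    have h2 := Nat.ceil_lt_add_one (show 0 ≤ C * w by positivity)
    linarith
  · filter_upwards [eventually_ge_atTop N] with n hn
    set w : ℝ := (n : ℝ) ^ (2 - 1 / (s : ℝ)) with hw'
    have hw0 : 0 ≤ w := by positivity
    rw [Real.norm_of_nonneg hw0, Real.norm_of_nonneg (by positivity),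
      le_inv_mul_iff₀ hc]
    obtain ⟨χ, hχ, hno⟩ := h n hn
    by_contra! hlt
    refine hno ((zTwo_isLeast n s T).1.2 χ fun k => ?_)
    exact_mod_cast hlt.le.trans (hχ k)

theorem proposition2p4 (s t : ℕ) (hs : 1 ≤ s)
    (hst : (s ≤ 3 ∧ 3 ≤ t) ∨ Nat.factorial (s - 1) + 1 ≤ t) :
    (∃ c C : ℝ, 0 < c ∧ 0 < C ∧ ∃ N : ℕ, ∀ n : ℕ, N ≤ n →
      ∃ χ : BipColoring n,
        c * (n : ℝ) ^ (2 - 1 / (s : ℝ)) ≤ (colorCount χ EdgeColor.blue : ℝ) ∧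
        (colorCount χ EdgeColor.blue : ℝ) ≤ C * (n : ℝ) ^ (2 - 1 / (s : ℝ)) ∧
        c * (n : ℝ) ^ (2 - 1 / (s : ℝ)) ≤ (colorCount χ EdgeColor.red : ℝ) ∧
        (BipK s t).Free (χ.labelGraph EdgeColor.blue) ∧
        ∀ T : ℕ, t ≤ T → ¬ HasPattern χ s T) ∧
    ∀ T : ℕ, t ≤ T →
      (fun n : ℕ => (zTwo n s T : ℝ)) =Θ[atTop]
        (fun n : ℕ => (n : ℝ) ^ (2 - 1 / (s : ℝ))) := by
  have ht : (s - 1).factorial + 1 ≤ t := by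
    rcases hst with ⟨h3, ht⟩ | h
    · refine le_trans ?_ ht
      interval_cases s <;> decide
    · exact h
  have hle : s ≤ t := by
    have := Nat.self_le_factorial (s - 1)
    omega
  obtain ⟨c, hc, h⟩ := exists_free_coloring hs ht
  refine ⟨⟨c, 1, hc, one_pos, 2 ^ s, fun n hn => ?_⟩, fun T hT => ?_⟩
  · obtain ⟨χ, h1, h2, h3, h4⟩ := h n hn
    exact ⟨χ, h1, by rwa [one_mul], h3, h4, fun T hT =>
      not_hasPattern_of_free hs (hle.trans hT) hT h4⟩
  · refine zTwo_isTheta hs (by omega) hc (N := 2 ^ s) fun n hn => ?_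
    obtain ⟨χ, h1, -, h3, h4⟩ := h n hn
    refine ⟨χ, fun k => ?_, not_hasPattern_of_free hs (hle.trans hT) hT h4⟩
    cases k
    · exact h3
    · exact h1
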